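/- Let $W_i=(Y_i,X_i,Z_i)$, $i\ge 1$, be i.i.d. with values in $\mathbb R\times\mathbb R^{p_x}\times\mathbb R^{p_z}$; write $W=(Y,X,Z)$ for a generic observation and $W^\dagger=(Y^\dagger,X^\dagger,Z^\dagger)$ for an independent copy. Let $g(x;\beta)$ be a regression function, $\mathcal B\subset\mathbb R^k$ compact, $\beta_o$ an interior point of $\mathcal B$, $U=Y-g(X;\beta_o)$, $r=\partial g(X;\beta_o)/\partial\beta$, and suppose that the null hypothesis $\mathbb E[U\mid Z]=0$ a.s. holds. *Kernel.* $\nu$ is a measure on $\mathbb R^{p_z}$, symmetric about the origin, and either $K(z)=\int(1-\cos(z's))\,\nu(ds)$ with $\int 1\wedge\|s\|^\alpha\,\nu(ds)<\infty$ for some $\alpha\in(0,2]$, or $\nu$ is finite and $K(z)=\int\cos(z's)\,\nu(ds)$. Every nonempty open set has positive $\nu$-measure or, if $Z$ is bounded, at least every nonempty open subset of some ball about the origin has. *The choice of $V$.* $h$ is measurable, $\mathbb E\,h(Z)^2<\infty$, $h(Z)$ is not a.s. equal to $\mathbb E\,h(Z)$, $V=[h(Z),\,U-h(Z)]'$, and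 $\hat V_i=[h(Z_i),\,\hat U_i-h(Z_i)]'$, where $\hat U_i=Y_i-g(X_i;\hat\beta_n)$ for an estimator $\hat\beta_n$ of $\beta_o$. *Conditions.* With $D=(U,V,Z)$, $\psi(D,D^\dagger)=\tfrac12K(Z-Z^\dagger)(UV^\dagger+U^\dagger V)$ and $\psi^{(1)}(D)=\mathbb E[\psi(D,D^\dagger)\mid D]$: 1. $\mathbb E U^2+\mathbb E K^2(Z-Z^\dagger)<\infty$ and $\mathbb E\|\psi(D,D^\dagger)\|^2<\infty$; moreover $\mathbb E[U^2\mid Z]>0$ a.s. 2. For almost every value $x$ of $X$, $g'(x;\beta)=\partial g(x;\beta)/\partial\beta$ exists and is continuous in $\beta\in\mathcal B$, and $\mathbb E\sup_{\beta\in\mathcal B}\|g'(X;\beta)\|<\infty$. 3. $\hat\beta_n$ is consistent and $\sqrt n(\hat\beta_n-\beta_o)=n^{-1/2}\sum_{i=1}^n\varphi_iU_i+o_p(1)$, where $\varphi_i=\varphi(X_i,Z_i;\beta_o)\in\mathbb R^k$, $\mathbb E[U\varphi]=0$, and $\Xi_0=\mathbb E[\varphi\varphi'U^2]$ exists and is positive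 definite. 4. For each $i$, $\hat V_i=V_i+\xi_i'(\hat\beta_n-\beta_o)+o_p(n^{-1/2})$ with $\xi_i=\xi(X_i,Z_i;\beta_o)\in\mathbb R^{k\times2}$, $\mathbb E\|\xi\|^2<\infty$; $\mathbb E[V\mid Z]$ is not a.s. zero; and $\Xi_1=\mathbb E[K(Z-Z^\dagger)(U\xi^{\dagger\prime}-V^\dagger r')]$ exists. Let $\Omega_{V_o}=4\,\mathrm{Var}(\psi^{(1)}(D))$, $\Xi_2=\mathbb E[\psi^{(1)}(D)U\varphi']$ and $$\Omega_{\delta_o}=\Omega_{V_o}+\Xi_1\Xi_0\Xi_1'+2\Xi_1\Xi_2'+2\Xi_2\Xi_1',$$ the null asymptotic covariance of $\sqrt n\,\hat\delta_n$, where $\hat\delta_n=\frac1{n(n-1)}\sum_{i\ne j}K(Z_i-Z_j)\hat U_i\hat V_j$. Put $\mu_h(z)=\mathbb E[K(z-Z)h(Z)]$. Then $\mathrm{rank}(\Omega_{V_o})=1$ and $\mathrm{rank}(\Omega_{\delta_o})\le1$, and $$\mathrm{rank}(\Omega_{\delta_o})=\mathrm{rank}(\Omega_{V_o})=1$$ if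 (and only if) the scalar random variable $\big(\mu_h(Z)-\mathbb E[\mu_h(Z)r']\varphi\big)U$ is not a.s. zero. Thus, outside this degenerate case, estimating $\beta_o$ does not change the degrees of freedom. -/

import Mathlib

open MeasureTheory ProbabilityTheory Filter Topology
open scoped Matrix ENNReal

noncomputable section

/-- Euclidean space of dimension `d`. -/
abbrev Euc (d : ℕ) : Type := EuclideanSpace ℝ (Fin d)

/-- One observation `(Y, X, Z)`: response, regressors, instruments. -/
abbrev Obs (px pz : ℕ) : Type := ℝ × Euc px × Euc pz

namespace Obs

variable {px pz : ℕ}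

def y (w : Obs px pz) : ℝ := w.1
def x (w : Obs px pz) : Euc px := w.2.1
def z (w : Obs px pz) : Euc pz := w.2.2

/-- The sigma-algebra generated by the instruments `Z`. -/
abbrev sigmaZ (px pz : ℕ) : MeasurableSpace (Obs px pz) :=
  MeasurableSpace.comap (fun w : Obs px pz => w.z) inferInstance

end Obs

/-! ### Kernels -/

/-- `K` is a kernel of a generalized martingale difference divergence with integrating measure `ν`,
where `ν` is symmetric about the origin. Either `K(z) = ∫ (1 - cos (z's)) ν(ds)`, with
`∫ 1 ∧ ‖s‖ ^ α ν(ds) < ∞` for some `α ∈ (0,2]` (which every finite measure satisfies), or `ν` is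
finite and `K(z) = ∫ cos (z's) ν(ds)` is its Fourier transform (as for the Gaussian kernel). -/
def IsGMDDKernel {pz : ℕ} (ν : Measure (Euc pz)) (K : Euc pz → ℝ) : Prop :=
  ν.map (fun s => -s) = ν ∧
    (((∃ α : ℝ, 0 < α ∧ α ≤ 2 ∧ ∫⁻ s, ENNReal.ofReal (min 1 (‖s‖ ^ α)) ∂ν < ⊤) ∧
        ∀ z, K z = ∫ s, (1 - Real.cos (inner ℝ z s)) ∂ν) ∨
      (IsFiniteMeasure ν ∧ ∀ z, K z = ∫ s, Real.cos (inner ℝ z s) ∂ν))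

/-- The integrating measure charges enough frequencies for an instrument with law `Q`: every
nonempty open set has positive mass or, if the instrument is bounded, at least every nonempty open
subset of some ball about the origin has. -/
def ChargesFrequencies {pz : ℕ} (ν : Measure (Euc pz)) (Q : Measure (Euc pz)) : Prop :=
  (∀ O : Set (Euc pz), IsOpen O → O.Nonempty → 0 < ν O) ∨
    ((∃ ε : ℝ, 0 < ε ∧
        ∀ O : Set (Euc pz), IsOpen O → O.Nonempty → O ⊆ Metric.ball 0 ε → 0 < ν O) ∧
      ∃ R : ℝ, ∀ᵐ z ∂Q, ‖z‖ ≤ R)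

/-! ### The model and its population quantities -/

/-- The known ingredients of a specification test, together with the true parameter: kernel `K`,
regression function `g(x;β)`, parameter space `B`, true parameter `β₀`, the map `(u,z) ↦ 𝒱(u,z)`,
and the functions `φ(x,z;β)` and `ξ(x,z;β)` of the expansions of the estimator and of `V`. -/
structure SpecModel (px pz k pv : ℕ) where
  K : Euc pz → ℝ
  g : Euc px → Euc k → ℝ
  B : Set (Euc k)
  β₀ : Euc k
  V : ℝ → Euc pz → Fin pv → ℝ
  φ : Euc px → Euc pz → Euc k → Euc k
  ξ : Euc px → Euc pz → Euc k → Matrix (Fin k) (Fin pv) ℝ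

namespace SpecModel

variable {px pz k pv : ℕ} (M : SpecModel px pz k pv) (P : Measure (Obs px pz))

/-- `Y - g(X;β)`: the error `U` at `β = β₀`, the residual at an estimate. -/
def resid (β : Euc k) (w : Obs px pz) : ℝ := w.y - M.g w.x β

/-- `U = Y - g(X;β₀)`. -/
def U (w : Obs px pz) : ℝ := M.resid M.β₀ w

/-- `𝒱(Y - g(X;β), Z)`: equal to `V` at `β = β₀`, to `V̂` at an estimate. -/
def Vat (β : Euc k) (w : Obs px pz) : Fin pv → ℝ := M.V (M.resid β w) w.z

/-- `r = ∂g(X;β₀)/∂β`. -/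
def r (w : Obs px pz) : Euc k := gradient (M.g w.x) M.β₀

/-- `φ(X,Z;β₀)`. -/
def phi (w : Obs px pz) : Euc k := M.φ w.x w.z M.β₀

/-- `ξ(X,Z;β₀)`. -/
def xi (w : Obs px pz) : Matrix (Fin k) (Fin pv) ℝ := M.ξ w.x w.z M.β₀

/-- `ψ(D,D') = (1/2) K(Z - Z') (U V' + U' V)`. -/
def psi (w w' : Obs px pz) (l : Fin pv) : ℝ :=
  1 / 2 * M.K (w.z - w'.z) * (M.U w * M.Vat M.β₀ w' l + M.U w' * M.Vat M.β₀ w l)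

/-- `ψ⁽¹⁾(D) = E[ψ(D,D') | D]`, where `D'` is an independent copy of `D`. -/
def psi1 (w : Obs px pz) (l : Fin pv) : ℝ := ∫ w', M.psi w w' l ∂P

/-- `Ω_V = 4 Var(ψ⁽¹⁾(D))`. -/
def OmegaV : Matrix (Fin pv) (Fin pv) ℝ :=
  Matrix.of fun l m => 4 * cov[fun w => M.psi1 P w l, fun w => M.psi1 P w m; P]

/-- `Ξ₀ = E[φ φ' U²]`. -/
def Xi0 : Matrix (Fin k) (Fin k) ℝ :=
  Matrix.of fun a b => ∫ w, M.phi w a * M.phi w b * M.U w ^ 2 ∂P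

/-- The integrand `K(Z - Z') (U ξ(X',Z')' - V(D') r')` of `Ξ₁`, for `q = (D, D')`. -/
def Xi1Integrand (q : Obs px pz × Obs px pz) (l : Fin pv) (a : Fin k) : ℝ :=
  M.K (q.1.z - q.2.z) * (M.U q.1 * M.xi q.2 a l - M.Vat M.β₀ q.2 l * M.r q.1 a)

/-- `Ξ₁`, an expectation over two independent copies. -/
def Xi1 : Matrix (Fin pv) (Fin k) ℝ :=
  Matrix.of fun l a => ∫ q, M.Xi1Integrand q l a ∂(P.prod P)

/-- `Ξ₂ = E[ψ⁽¹⁾(D) U φ']`. -/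
def Xi2 : Matrix (Fin pv) (Fin k) ℝ :=
  Matrix.of fun l a => ∫ w, M.psi1 P w l * M.U w * M.phi w a ∂P

/-- `Ω_δ = Ω_V + Ξ₁ Ξ₀ Ξ₁' + 2 Ξ₁ Ξ₂' + 2 Ξ₂ Ξ₁'`. -/
def OmegaDelta : Matrix (Fin pv) (Fin pv) ℝ :=
  M.OmegaV P + M.Xi1 P * M.Xi0 P * (M.Xi1 P)ᵀ
    + (2 : ℝ) • (M.Xi1 P * (M.Xi2 P)ᵀ) + (2 : ℝ) • (M.Xi2 P * (M.Xi1 P)ᵀ)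

/-- The estimate of `β₀` computed by `T` from the first `n` observations. -/
def betaHat {Ω : Type*} (T : (n : ℕ) → (Fin n → Obs px pz) → Euc k) (W : ℕ → Ω → Obs px pz)
    (n : ℕ) (ω : Ω) : Euc k :=
  T n (fun i => W i ω)

/-- The null hypothesis at `β₀`: `E[Y - g(X;β₀) | Z] = 0` almost surely. -/
def Null : Prop := P[M.U | Obs.sigmaZ px pz] =ᵐ[P] 0

/-- Moment conditions: `E U² + E K(Z - Z')² < ∞`, `E ‖ψ(D,D')‖² < ∞`, and `Ξ₁` exists. -/
structure MomentConditions : Prop where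
  memLp_U : MemLp M.U 2 P
  memLp_K : MemLp (fun q : Obs px pz × Obs px pz => M.K (q.1.z - q.2.z)) 2 (P.prod P)
  memLp_psi : ∀ l, MemLp (fun q : Obs px pz × Obs px pz => M.psi q.1 q.2 l) 2 (P.prod P)
  integrable_Xi1 : ∀ l a, Integrable (fun q => M.Xi1Integrand q l a) (P.prod P)

/-- Smoothness of the regression function. The function `g'` is the derivative of `g(x;·)` on the
compact set `B`, for almost every value `x` of the regressors. -/
structure RegressionConditions : Prop where
  isCompact_B : IsCompact M.B
  measurable_g : ∀ β, Measurable fun x => M.g x β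
  exists_deriv : ∃ g' : Euc px → Euc k → Euc k,
    (∀ᵐ w ∂P, (∀ β ∈ M.B, HasGradientWithinAt (M.g w.x) (g' w.x β) M.B β) ∧
      ContinuousOn (g' w.x) M.B) ∧
    ∫⁻ w, ⨆ β ∈ M.B, ‖g' w.x β‖ₑ ∂P < ⊤

/-- The estimator under the null hypothesis: `β₀` is interior, the estimator is consistent and
`√n (β̂ₙ - β₀) = n^(-1/2) ∑_{i<n} φᵢ Uᵢ + o_p(1)` with `E[U φ] = 0`, and `Ξ₀` exists and is positive
definite. -/
structure EstimatorConditions {Ω : Type*} [MeasurableSpace Ω] (μ : Measure Ω)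
    (W : ℕ → Ω → Obs px pz) (T : (n : ℕ) → (Fin n → Obs px pz) → Euc k) : Prop where
  interior_β₀ : M.β₀ ∈ interior M.B
  measurable_T : ∀ n, Measurable (T n)
  consistent : TendstoInMeasure μ (betaHat T W) atTop (fun _ => M.β₀)
  measurable_φ : ∀ β, Measurable fun q : Euc px × Euc pz => M.φ q.1 q.2 β
  bahadur : TendstoInMeasure μ
    (fun (n : ℕ) (ω : Ω) => √(n : ℝ) • (betaHat T W n ω - M.β₀)
      - (√(n : ℝ))⁻¹ • ∑ i ∈ Finset.range n, M.U (W i ω) • M.phi (W i ω))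
    atTop (fun _ => 0)
  centered : ∀ a, ∫ w, M.U w * M.phi w a ∂P = 0
  integrable_Xi0 : ∀ a b, Integrable (fun w => M.phi w a * M.phi w b * M.U w ^ 2) P
  posDef_Xi0 : (M.Xi0 P).PosDef

/-- The expansion `V̂ᵢ = Vᵢ + ξᵢ' (β̂ₙ - β₀) + o_p(n^(-1/2))`, with `E ‖ξ‖² < ∞` and `E[V | Z]` not
almost surely zero. -/
structure VExpansionConditions {Ω : Type*} [MeasurableSpace Ω] (μ : Measure Ω)
    (W : ℕ → Ω → Obs px pz) (T : (n : ℕ) → (Fin n → Obs px pz) → Euc k) : Prop where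
  measurable_ξ : ∀ β a l, Measurable fun q : Euc px × Euc pz => M.ξ q.1 q.2 β a l
  expansion : ∀ i, TendstoInMeasure μ
    (fun (n : ℕ) (ω : Ω) => √(n : ℝ) • (M.Vat (betaHat T W n ω) (W i ω) - M.Vat M.β₀ (W i ω)
      - (M.xi (W i ω))ᵀ *ᵥ (fun a => betaHat T W n ω a - M.β₀ a)))
    atTop (fun _ => 0)
  memLp_xi : ∀ a l, MemLp (fun w => M.xi w a l) 2 P
  nondegenerate : ¬ ∀ l, P[fun w => M.Vat M.β₀ w l | Obs.sigmaZ px pz] =ᵐ[P] 0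

/-- `μ_h(z) = E[K(z - Z) h(Z)]`. -/
def muh (h : Euc pz → ℝ) (z : Euc pz) : ℝ := ∫ w, M.K (z - w.z) * h w.z ∂P

/-- `U (μ_h(Z) - E[μ_h(Z) r'] φ)`: the influence of one observation, accounting for the estimation
of `β₀`. -/
def influence (h : Euc pz → ℝ) (w : Obs px pz) : ℝ :=
  M.U w * (M.muh P h w.z - ∑ a, (∫ v, M.muh P h v.z * M.r v a ∂P) * M.phi w a)

end SpecModel

/-- The map `(u,z) ↦ [h(z), u - h(z)]`. -/
def pairV {pz : ℕ} (h : Euc pz → ℝ) (u : ℝ) (z : Euc pz) : Fin 2 → ℝ := ![h z, u - h z]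

end

/-! ### Characteristic functions -/

/-! Under the null, averaging `K(Z - Z') U'` over the copy with `Z` frozen gives zero. So only `h`
survives in the population quantities, and it enters the two coordinates of `V` with opposite signs.
With `e = (1,-1)`: `ψ⁽¹⁾ = ½ U μ_h(Z) e`, `Ξ₁ = -e E[μ_h r']`, `Ξ₂ = ½ e E[U² μ_h φ']`. Completing
the square, `Ω_V = E[(U μ_h)²] e e'` and `Ω_δ = E[influence²] e e'` (`OmegaV_apply`,
`OmegaDelta_apply`); each rank is 0 or 1 according to whether a scalar vanishes.

It remains to see that `E[(U μ_h)²] ≠ 0`. As `E[U² | Z] > 0`, otherwise `μ_h(Z) = 0` a.s. Take `f =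
E h - h` for the kernel `1 - cos` and `f = h` for the kernel `cos`. Up to sign, the quadratic form
of `K` at `f` is the `ν`-integral of `|f̂|²`, with `f̂` the Fourier transform of `f` against the law
of `Z`; `μ_h = 0` forces that integral to be nonpositive, so `f̂ = 0` `ν`-a.e. Then `f = 0`
(`ae_eq_zero_of_fourier_eq_zero`), by continuity of `f̂` if `ν` charges all open sets, by analytic
continuation from a ball if `Z` is bounded. Thus `h(Z)` would be constant. -/

theorem complexMGF_inner_mul_I {d : ℕ} (m : Measure (Euc d)) (s : Euc d) (t : ℝ) :
    complexMGF (fun z => inner ℝ z s) m (t * Complex.I) = charFun m (t • s) := by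
  rw [complexMGF, charFun_apply]
  congr 1 with z
  rw [inner_smul_right]
  push_cast
  ring_nf

/-- Bounded support makes every exponential moment finite, so the strip of analyticity is the whole
plane. -/
theorem analyticOnNhd_complexMGF_inner {d : ℕ} (m : Measure (Euc d)) [IsFiniteMeasure m] {R : ℝ}
    (hR : ∀ᵐ z ∂m, ‖z‖ ≤ R) (s : Euc d) :
    AnalyticOnNhd ℂ (complexMGF (fun z => inner ℝ z s) m) Set.univ := by
  have huniv : integrableExpSet (fun z : Euc d => inner ℝ z s) m = Set.univ := by
    refine Set.eq_univ_of_forall fun t => ?_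
    refine Integrable.of_bound (by fun_prop) (Real.exp (|t| * (R * ‖s‖))) ?_
    filter_upwards [hR] with z hz
    rw [Real.norm_eq_abs, Real.abs_exp]
    refine Real.exp_le_exp.2 ((le_abs_self _).trans ?_)
    rw [abs_mul]
    gcongr
    exact (abs_real_inner_le_norm z s).trans (by gcongr)
  have := analyticOnNhd_complexMGF (X := fun z : Euc d => inner ℝ z s) (μ := m)
  simpa [huniv] using this

/-- Characteristic functions of boundedly supported measures are determined near the origin. -/
theorem charFun_eq_of_eqOn_ball {d : ℕ} {m₁ m₂ : Measure (Euc d)} [IsFiniteMeasure m₁]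
    [IsFiniteMeasure m₂] {R ε : ℝ} (h₁ : ∀ᵐ z ∂m₁, ‖z‖ ≤ R) (h₂ : ∀ᵐ z ∂m₂, ‖z‖ ≤ R)
    (hε : 0 < ε) (heq : ∀ s ∈ Metric.ball (0 : Euc d) ε, charFun m₁ s = charFun m₂ s) :
    charFun m₁ = charFun m₂ := by
  ext s
  have hlim : Tendsto (fun n : ℕ => (1 : ℝ) / (n + 1)) atTop (𝓝 0) :=
    tendsto_one_div_add_atTop_nhds_zero_nat
  -- The points `i/(n+1)` accumulate at 0 without reaching it, as the identity theorem requires.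
  have hlimI : Tendsto (fun n : ℕ => (((1 : ℝ) / (n + 1) : ℝ) : ℂ) * Complex.I) atTop
      (𝓝[≠] 0) := by
    refine tendsto_nhdsWithin_iff.2 ⟨?_, Eventually.of_forall fun n => ?_⟩
    · have := (Complex.continuous_ofReal.tendsto 0).comp hlim
      simpa [Function.comp_def] using this.mul_const Complex.I
    · have : ((1 : ℝ) / (n + 1) : ℝ) ≠ 0 := by positivity
      exact mul_ne_zero (Complex.ofReal_ne_zero.2 this) Complex.I_ne_zero
  have hsmul : ∀ᶠ n : ℕ in atTop, ((1 : ℝ) / (n + 1)) • s ∈ Metric.ball (0 : Euc d) ε := by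
    have : Tendsto (fun n : ℕ => ((1 : ℝ) / (n + 1)) • s) atTop (𝓝 0) := by
      simpa using hlim.smul_const s
    exact this.eventually (Metric.ball_mem_nhds _ hε)
  -- On the imaginary axis these entire functions are the characteristic functions along the line `ℝ
  -- s`, which agree near 0; evaluation at `i` then gives the point `s`.
  have hEq : complexMGF (fun z => inner ℝ z s) m₁ = complexMGF (fun z => inner ℝ z s) m₂ := by
    refine (analyticOnNhd_complexMGF_inner m₁ h₁ s).eq_of_frequently_eq
      (analyticOnNhd_complexMGF_inner m₂ h₂ s) (z₀ := 0) ?_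
    refine hlimI.frequently (Eventually.frequently ?_)
    filter_upwards [hsmul] with n hn
    rw [complexMGF_inner_mul_I, complexMGF_inner_mul_I, heq _ hn]
  have := congrFun hEq (((1 : ℝ) : ℂ) * Complex.I)
  rwa [complexMGF_inner_mul_I, complexMGF_inner_mul_I, one_smul] at this

/-- The positive and negative parts of `f` turn a statement about the Fourier transform of a signed
density into one about two finite measures, to which uniqueness of characteristic functions applies.
-/
theorem charFun_withDensity_ofReal_sub {d : ℕ} (Q : Measure (Euc d)) [IsFiniteMeasure Q]
    {f : Euc d → ℝ} (hf : Measurable f) (hint : Integrable f Q) (s : Euc d) :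
    charFun (Q.withDensity fun z => ENNReal.ofReal (f z)) s -
      charFun (Q.withDensity fun z => ENNReal.ofReal (-f z)) s =
      ((∫ z, f z * Real.cos (inner ℝ z s) ∂Q : ℝ) : ℂ) +
        ((∫ z, f z * Real.sin (inner ℝ z s) ∂Q : ℝ) : ℂ) * Complex.I := by
  have hbd : ∀ g : Euc d → ℝ, Integrable g Q →
      Integrable (fun z => g z • Complex.exp (inner ℝ z s * Complex.I)) Q := fun g hg =>
    hg.smul_bdd (f := fun z => Complex.exp (inner ℝ z s * Complex.I)) 1 (by fun_prop)
      (Eventually.of_forall fun z => by rw [Complex.norm_exp_ofReal_mul_I])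
  have hcos : Integrable (fun z => f z * Real.cos (inner ℝ z s)) Q :=
    hint.mul_bdd (c := 1) (by fun_prop) (Eventually.of_forall fun z => Real.abs_cos_le_one _)
  have hsin : Integrable (fun z => f z * Real.sin (inner ℝ z s)) Q :=
    hint.mul_bdd (c := 1) (by fun_prop) (Eventually.of_forall fun z => Real.abs_sin_le_one _)
  rw [charFun_apply, charFun_apply, integral_withDensity_eq_integral_toReal_smul (by fun_prop)
    (by simp), integral_withDensity_eq_integral_toReal_smul (by fun_prop) (by simp),
    ← integral_sub, ← integral_complex_ofReal, ← integral_complex_ofReal, ← integral_mul_const, ← integral_add]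
  · congr 1 with z
    rw [Complex.exp_mul_I, ← sub_smul, ENNReal.toReal_ofReal', ENNReal.toReal_ofReal',
      max_zero_sub_max_neg_zero_eq_self]
    simp
    ring
  · exact hcos.ofReal
  · exact hsin.ofReal.mul_const _
  · exact hbd _ (by simpa [ENNReal.toReal_ofReal'] using hint.pos_part)
  · exact hbd _ (by simpa [ENNReal.toReal_ofReal'] using hint.neg_part)

/-- A function whose Fourier transform vanishes `ν`-almost everywhere is zero. -/
theorem ae_eq_zero_of_fourier_eq_zero {d : ℕ} {ν Q : Measure (Euc d)} [IsFiniteMeasure Q]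
    (hν : ChargesFrequencies ν Q) {f : Euc d → ℝ} (hf : Measurable f) (hint : Integrable f Q)
    (hcos : ∀ᵐ s ∂ν, ∫ z, f z * Real.cos (inner ℝ z s) ∂Q = 0)
    (hsin : ∀ᵐ s ∂ν, ∫ z, f z * Real.sin (inner ℝ z s) ∂Q = 0) : f =ᵐ[Q] 0 := by
  set m₁ := Q.withDensity fun z => ENNReal.ofReal (f z)
  set m₂ := Q.withDensity fun z => ENNReal.ofReal (-f z)
  have hfin : ∫⁻ z, ENNReal.ofReal (f z) ∂Q ≠ ∞ := hint.lintegral_lt_top.ne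
  have : IsFiniteMeasure m₁ := isFiniteMeasure_withDensity_ofReal hint.2
  have : IsFiniteMeasure m₂ := isFiniteMeasure_withDensity_ofReal hint.neg.2
  have hae : ∀ᵐ s ∂ν, charFun m₁ s = charFun m₂ s := by
    filter_upwards [hcos, hsin] with s hc hs
    rw [← sub_eq_zero, charFun_withDensity_ofReal_sub Q hf hint, hc, hs]
    simp
  -- A `ν`-null set of disagreement that is also open cannot meet a region where `ν` charges every
  -- nonempty open set.
  have hopen : IsOpen {s | charFun m₁ s ≠ charFun m₂ s} :=
    isOpen_ne_fun continuous_charFun continuous_charFun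
  have hnull : ν {s | charFun m₁ s ≠ charFun m₂ s} = 0 := hae
  have hchar : charFun m₁ = charFun m₂ := by
    rcases hν with hν | ⟨⟨ε, hε, hν⟩, R, hR⟩
    · ext s
      by_contra hs
      exact (hν _ hopen ⟨s, hs⟩).ne' hnull
    · refine charFun_eq_of_eqOn_ball ((withDensity_absolutelyContinuous _ _).ae_le hR)
        ((withDensity_absolutelyContinuous _ _).ae_le hR) hε fun s hs => ?_
      by_contra hne
      exact (hν _ (hopen.inter Metric.isOpen_ball) ⟨s, hne, hs⟩ Set.inter_subset_right).ne'
        (measure_mono_null Set.inter_subset_left hnull)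
  have hdens := (withDensity_eq_iff (by fun_prop) (by fun_prop) hfin).1
    (Measure.ext_of_charFun hchar)
  filter_upwards [hdens] with z hz
  have := congrArg ENNReal.toReal hz
  rw [ENNReal.toReal_ofReal', ENNReal.toReal_ofReal'] at this
  rw [Pi.zero_apply, ← max_zero_sub_max_neg_zero_eq_self (f z), this, sub_self]

/-! ### Kernels -/

theorem IsGMDDKernel.measurable {d : ℕ} {ν : Measure (Euc d)} [SFinite ν] {K : Euc d → ℝ}
    (hK : IsGMDDKernel ν K) : Measurable K := by
  rcases hK.2 with ⟨-, h⟩ | ⟨-, h⟩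
  · rw [show K = _ from funext h]
    exact (StronglyMeasurable.integral_prod_right (f := fun z s => 1 - Real.cos (inner ℝ z s))
      (by unfold Function.uncurry; exact Continuous.stronglyMeasurable (by fun_prop))).measurable
  · rw [show K = _ from funext h]
    exact (StronglyMeasurable.integral_prod_right (f := fun z s => Real.cos (inner ℝ z s))
      (by unfold Function.uncurry; exact Continuous.stronglyMeasurable (by fun_prop))).measurable

theorem integrable_one_sub_cos_inner {d : ℕ} {ν : Measure (Euc d)} {α : ℝ} (h0 : 0 < α)
    (h2 : α ≤ 2) (hν : ∫⁻ s, ENNReal.ofReal (min 1 (‖s‖ ^ α)) ∂ν < ⊤) (z : Euc d) :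
    Integrable (fun s => 1 - Real.cos (inner ℝ z s)) ν := by
  have hmeas : Measurable fun s : Euc d => min 1 (‖s‖ ^ α) := by fun_prop
  have hint : Integrable (fun s : Euc d => min 1 (‖s‖ ^ α)) ν :=
    (lintegral_ofReal_ne_top_iff_integrable hmeas.aestronglyMeasurable
      (Eventually.of_forall fun s => by positivity)).1 hν.ne
  -- The 2 bounds `1 - cos` where `‖s‖ ≥ 1`; for `‖s‖ ≤ 1`, `1 - cos x ≤ x²/2` and `‖s‖² ≤ ‖s‖ ^ α`
  -- (as `α ≤ 2`) account for `‖z‖²`.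
  refine (hint.const_mul (2 + ‖z‖ ^ 2)).mono' (by fun_prop) (Eventually.of_forall fun s => ?_)
  have hle := Real.cos_le_one (inner ℝ z s)
  rw [Real.norm_eq_abs, abs_of_nonneg (by linarith)]
  rcases le_total 1 ‖s‖ with hs | hs
  · rw [min_eq_left (Real.one_le_rpow hs h0.le)]
    nlinarith [Real.neg_one_le_cos (inner ℝ z s), sq_nonneg ‖z‖]
  · rw [min_eq_right (Real.rpow_le_one (norm_nonneg s) hs h0.le)]
    have h1 : ‖s‖ ^ 2 ≤ ‖s‖ ^ α := by
      rcases (norm_nonneg s).eq_or_lt with h | h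
      · rw [← h, Real.zero_rpow h0.ne']; norm_num
      · rw [← Real.rpow_two]; exact Real.rpow_le_rpow_of_exponent_ge h hs h2
    have h3 : (inner ℝ z s) ^ 2 ≤ (‖z‖ * ‖s‖) ^ 2 :=
      sq_le_sq' (by linarith [neg_abs_le (inner ℝ z s), abs_real_inner_le_norm z s])
        (real_inner_le_norm z s)
    have h4 := Real.one_sub_sq_div_two_le_cos (x := inner ℝ z s)
    have h5 : 0 ≤ ‖s‖ ^ α := by positivity
    nlinarith [sq_nonneg ‖z‖, mul_le_mul_of_nonneg_left h1 (sq_nonneg ‖z‖),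
      mul_nonneg (sq_nonneg ‖z‖) h5]

/-! ### Square-integrable functions on products -/

theorem memLp_two_mul_prod {α β : Type*} [MeasurableSpace α] [MeasurableSpace β] {μ : Measure α}
    {ν : Measure β} [IsFiniteMeasure μ] [IsFiniteMeasure ν] {f : α → ℝ} {g : β → ℝ}
    (hf : MemLp f 2 μ) (hg : MemLp g 2 ν) :
    MemLp (fun q : α × β => f q.1 * g q.2) 2 (μ.prod ν) := by
  refine (memLp_two_iff_integrable_sq
    ((hf.integrable one_le_two).mul_prod (hg.integrable one_le_two)).1).2 ?_
  simpa only [mul_pow] using hf.integrable_sq.mul_prod hg.integrable_sq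

theorem integrable_mul_mul_prod {α β : Type*} [MeasurableSpace α] [MeasurableSpace β]
    {μ : Measure α} {ν : Measure β} [IsFiniteMeasure μ] [IsFiniteMeasure ν] {f : α → ℝ}
    {g : β → ℝ} {K : α × β → ℝ} (hf : MemLp f 2 μ) (hg : MemLp g 2 ν)
    (hK : MemLp K 2 (μ.prod ν)) :
    Integrable (fun q : α × β => f q.1 * g q.2 * K q) (μ.prod ν) :=
  (memLp_two_mul_prod hf hg).integrable_mul hK

/-! ### The quadratic form of a kernel -/

/-- The addition formula for the cosine splits the integrand into products of functions of one
variable. The constant contributes `a (∫ f)²`, removed by `ha`: either `a = 0` or `f` is centered,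
which covers both forms of the kernel. -/
theorem integral_prod_mul_cos_inner_sub {d : ℕ} {Q : Measure (Euc d)} [IsFiniteMeasure Q]
    {f : Euc d → ℝ} (hint : Integrable f Q) {a b : ℝ} (ha : a * ∫ z, f z ∂Q = 0) (s : Euc d) :
    ∫ q, f q.1 * f q.2 * (a + b * Real.cos (inner ℝ (q.1 - q.2) s)) ∂(Q.prod Q) =
      b * ((∫ z, f z * Real.cos (inner ℝ z s) ∂Q) ^ 2 +
        (∫ z, f z * Real.sin (inner ℝ z s) ∂Q) ^ 2) := by
  have hcos : Integrable (fun z => f z * Real.cos (inner ℝ z s)) Q :=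
    hint.mul_bdd (c := 1) (by fun_prop) (Eventually.of_forall fun z => Real.abs_cos_le_one _)
  have hsin : Integrable (fun z => f z * Real.sin (inner ℝ z s)) Q :=
    hint.mul_bdd (c := 1) (by fun_prop) (Eventually.of_forall fun z => Real.abs_sin_le_one _)
  calc ∫ q, f q.1 * f q.2 * (a + b * Real.cos (inner ℝ (q.1 - q.2) s)) ∂(Q.prod Q)
      = ∫ q, (a * (f q.1 * f q.2) + (b * ((f q.1 * Real.cos (inner ℝ q.1 s)) *
          (f q.2 * Real.cos (inner ℝ q.2 s))) + b * ((f q.1 * Real.sin (inner ℝ q.1 s)) *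
          (f q.2 * Real.sin (inner ℝ q.2 s))))) ∂(Q.prod Q) := by
        congr 1 with q
        rw [inner_sub_left, Real.cos_sub]
        ring
    _ = _ := by
        have hsum : Integrable (fun q : Euc d × Euc d =>
            b * ((f q.1 * Real.cos (inner ℝ q.1 s)) * (f q.2 * Real.cos (inner ℝ q.2 s))) +
            b * ((f q.1 * Real.sin (inner ℝ q.1 s)) * (f q.2 * Real.sin (inner ℝ q.2 s))))
            (Q.prod Q) :=
          ((hcos.mul_prod hcos).const_mul b).add ((hsin.mul_prod hsin).const_mul b)
        rw [integral_add ((hint.mul_prod hint).const_mul a) hsum, integral_add ((hcos.mul_prod hcos).const_mul b)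
          ((hsin.mul_prod hsin).const_mul b), integral_const_mul, integral_const_mul,
          integral_const_mul, integral_prod_mul,
          integral_prod_mul (fun z => f z * Real.cos (inner ℝ z s)) fun z => f z * Real.cos (inner ℝ z s),
          integral_prod_mul (fun z => f z * Real.sin (inner ℝ z s)) fun z => f z * Real.sin (inner ℝ z s),
          ← mul_assoc, ha]
        ring

/-- By Fubini the form is `b ∫ |f̂|² dν`, so `b` times it is `b² ∫ |f̂|² dν`, and nonpositivity
forces `f̂ = 0` whatever the sign of `b`. The function `L` supplies the absolute integrability; it
is `K` itself for `1 - cos`, but not for `cos`, which changes sign. -/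
theorem fourier_eq_zero_of_quadratic_nonpos {d : ℕ} {ν Q : Measure (Euc d)} [SFinite ν]
    [IsFiniteMeasure Q] {f : Euc d → ℝ} (hf : MemLp f 2 Q) {K L : Euc d → ℝ} {a b : ℝ}
    (ha : a * ∫ z, f z ∂Q = 0) (hb : b ≠ 0)
    (hκ : ∀ z, Integrable (fun s => a + b * Real.cos (inner ℝ z s)) ν)
    (hK : ∀ z, K z = ∫ s, (a + b * Real.cos (inner ℝ z s)) ∂ν)
    (hL : ∀ z, ∫ s, ‖a + b * Real.cos (inner ℝ z s)‖ ∂ν = L z)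
    (hL2 : MemLp (fun q : Euc d × Euc d => L (q.1 - q.2)) 2 (Q.prod Q))
    (hq : b * ∫ q, f q.1 * f q.2 * K (q.1 - q.2) ∂(Q.prod Q) ≤ 0) :
    (∀ᵐ s ∂ν, ∫ z, f z * Real.cos (inner ℝ z s) ∂Q = 0) ∧
      ∀ᵐ s ∂ν, ∫ z, f z * Real.sin (inner ℝ z s) ∂Q = 0 := by
  have hint : Integrable f Q := hf.integrable one_le_two
  have hff := memLp_two_mul_prod hf hf
  have hF : Integrable (fun p : (Euc d × Euc d) × Euc d =>
      f p.1.1 * f p.1.2 * (a + b * Real.cos (inner ℝ (p.1.1 - p.1.2) p.2)))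
      ((Q.prod Q).prod ν) := by
    have hmeas : AEStronglyMeasurable (fun p : (Euc d × Euc d) × Euc d =>
        f p.1.1 * f p.1.2 * (a + b * Real.cos (inner ℝ (p.1.1 - p.1.2) p.2)))
        ((Q.prod Q).prod ν) :=
      (hff.1.comp_fst (ν := ν)).mul (Continuous.aestronglyMeasurable (by fun_prop))
    refine (integrable_prod_iff hmeas).2 ⟨Eventually.of_forall fun q =>
      (hκ (q.1 - q.2)).const_mul (f q.1 * f q.2), ?_⟩
    have := (hff.norm.integrable_mul hL2)
    refine this.congr (Eventually.of_forall fun q => ?_)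
    simp only [Pi.mul_apply, norm_mul (f q.1 * f q.2), integral_const_mul, hL]
  have hswap := hF.integral_prod_right
  simp only [integral_prod_mul_cos_inner_sub hint ha] at hswap
  have hsum := (integrable_const_mul_iff hb.isUnit _).1 hswap
  have heq : ∫ q, f q.1 * f q.2 * K (q.1 - q.2) ∂(Q.prod Q) =
      b * ∫ s, ((∫ z, f z * Real.cos (inner ℝ z s) ∂Q) ^ 2 +
        (∫ z, f z * Real.sin (inner ℝ z s) ∂Q) ^ 2) ∂ν := by
    rw [← integral_const_mul]
    simp only [← integral_prod_mul_cos_inner_sub hint ha, hK, ← integral_const_mul]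
    exact integral_integral_swap hF
  have hzero : ∫ s, ((∫ z, f z * Real.cos (inner ℝ z s) ∂Q) ^ 2 +
        (∫ z, f z * Real.sin (inner ℝ z s) ∂Q) ^ 2) ∂ν = 0 := by
    refine le_antisymm ?_ (integral_nonneg fun s => by positivity)
    rw [heq, ← mul_assoc, ← sq] at hq
    exact nonpos_of_mul_nonpos_right hq (by positivity)
  have hae := (integral_eq_zero_iff_of_nonneg (fun s => by positivity) hsum).1 hzero
  constructor <;> filter_upwards [hae] with s hs <;> simp only [Pi.zero_apply] at hs <;> nlinarith

/-- If `E[K(z - Z) h(Z)]` vanishes at almost every value `z` of `Z`, then `h(Z)` is constant. -/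
theorem IsGMDDKernel.ae_eq_const_of_integral_eq_zero {d : ℕ} {ν Q : Measure (Euc d)} [SFinite ν]
    [IsProbabilityMeasure Q] {K : Euc d → ℝ} (hK : IsGMDDKernel ν K)
    (hν : ChargesFrequencies ν Q) {h : Euc d → ℝ} (hmeas : Measurable h) (hL2 : MemLp h 2 Q)
    (hK2 : MemLp (fun q : Euc d × Euc d => K (q.1 - q.2)) 2 (Q.prod Q))
    (hzero : ∀ᵐ z ∂Q, ∫ z', K (z - z') * h z' ∂Q = 0) :
    ∀ᵐ z ∂Q, h z = ∫ z', h z' ∂Q := by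
  have hint : Integrable h Q := hL2.integrable one_le_two
  have hform : ∀ g : Euc d → ℝ, MemLp g 2 Q →
      ∫ q, g q.1 * h q.2 * K (q.1 - q.2) ∂(Q.prod Q) = 0 := by
    intro g hg
    rw [integral_prod _ (integrable_mul_mul_prod hg hL2 hK2)]
    refine integral_eq_zero_of_ae ?_
    filter_upwards [hzero] with z hz
    simp only [mul_assoc, integral_const_mul, mul_comm (h _), hz, mul_zero, Pi.zero_apply]
  rcases hK.2 with ⟨⟨α, hα0, hα2, hα⟩, hKeq⟩ | ⟨hfin, hKeq⟩
  -- For `1 - cos` the form is a negative multiple of `∫ |f̂|² dν` only on centered functions, hence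
  -- `f = m - h`. Its terms containing a factor `h` integrate to zero, leaving `m² ∫ K ≥ 0`, the
  -- opposite sign.
  · set m := ∫ z, h z ∂Q with hm
    have hpos : ∀ z, 0 ≤ K z := fun z => by
      rw [hKeq]; exact integral_nonneg fun s => sub_nonneg.2 (Real.cos_le_one _)
    have hsymm : ∀ z, K (-z) = K z := fun z => by simp [hKeq, inner_neg_left]
    have hfmem : MemLp (fun z => m - h z) 2 Q := (memLp_const m).sub hL2
    have hmean : ∫ z, (m - h z) ∂Q = 0 := by
      rw [integral_sub (integrable_const _) hint]; simp [hm]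
    have hprod : ∀ g₁ g₂ : Euc d → ℝ, MemLp g₁ 2 Q → MemLp g₂ 2 Q →
        Integrable (fun q : Euc d × Euc d => g₁ q.1 * g₂ q.2 * K (q.1 - q.2)) (Q.prod Q) :=
      fun g₁ g₂ h₁ h₂ => integrable_mul_mul_prod h₁ h₂ hK2
    have hquad : 0 ≤ ∫ q, (m - h q.1) * (m - h q.2) * K (q.1 - q.2) ∂(Q.prod Q) := by
      have hc : MemLp (fun _ : Euc d => m) 2 Q := memLp_const m
      have e1 : ∫ q, h q.1 * m * K (q.1 - q.2) ∂(Q.prod Q) = 0 := by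
        rw [← integral_prod_swap, ← hform _ hc]
        congr 1 with q
        simp only [Prod.fst_swap, Prod.snd_swap]
        rw [← neg_sub q.1 q.2, hsymm]
        ring
      have e2 : ∫ q, (m - h q.1) * (m - h q.2) * K (q.1 - q.2) ∂(Q.prod Q) =
          ∫ q, m * m * K (q.1 - q.2) ∂(Q.prod Q) := by
        have : ∀ q : Euc d × Euc d, (m - h q.1) * (m - h q.2) * K (q.1 - q.2) =
            m * m * K (q.1 - q.2) - h q.1 * m * K (q.1 - q.2)
              - (m - h q.1) * h q.2 * K (q.1 - q.2) := fun q => by ring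
        have hsub : Integrable (fun q : Euc d × Euc d =>
            m * m * K (q.1 - q.2) - h q.1 * m * K (q.1 - q.2)) (Q.prod Q) :=
          (hprod _ _ hc hc).sub (hprod _ _ hL2 hc)
        simp only [this]
        rw [integral_sub hsub (hprod _ _ hfmem hL2),
          integral_sub (hprod _ _ hc hc) (hprod _ _ hL2 hc), e1, hform _ hfmem]
        simp
      rw [e2]
      exact integral_nonneg fun q => mul_nonneg (mul_self_nonneg m) (hpos _)
    obtain ⟨hc, hs⟩ := fourier_eq_zero_of_quadratic_nonpos (ν := ν) (K := K) (L := K) (a := 1)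
      (b := -1) hfmem (by rw [hmean, mul_zero]) (by norm_num)
      (fun z => by
        simpa [sub_eq_add_neg] using integrable_one_sub_cos_inner hα0 hα2 hα z)
      (fun z => by simp [hKeq, sub_eq_add_neg])
      (fun z => by
        rw [hKeq]
        congr 1 with s
        rw [Real.norm_eq_abs, abs_of_nonneg (by linarith [Real.cos_le_one (inner ℝ z s)])]
        ring) hK2 (by linarith)
    filter_upwards [ae_eq_zero_of_fourier_eq_zero hν (by fun_prop)
      (hfmem.integrable one_le_two) hc hs] with z hz
    rw [Pi.zero_apply] at hz
    linarith
  -- For `cos` no centering is needed (`a = 0`), and `h` itself vanishes, so its mean does too.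
  · obtain ⟨hc, hs⟩ := fourier_eq_zero_of_quadratic_nonpos (ν := ν) (K := K)
      (L := fun z => ∫ s, ‖0 + 1 * Real.cos (inner ℝ z s)‖ ∂ν) (a := 0) (b := 1) hL2 (by simp)
      one_ne_zero
      (fun z => Integrable.of_bound (by fun_prop) 1 (Eventually.of_forall fun s => by
        simpa using Real.abs_cos_le_one (inner ℝ z s)))
      (fun z => by simp [hKeq]) (fun z => rfl)
      (by
        refine MemLp.of_bound ?_ (ν.real Set.univ) (Eventually.of_forall fun q => ?_)
        · have : StronglyMeasurable fun z : Euc d => ∫ s, ‖0 + 1 * Real.cos (inner ℝ z s)‖ ∂ν :=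
            StronglyMeasurable.integral_prod_right
              (f := fun z s => ‖0 + 1 * Real.cos (inner ℝ z s)‖)
              (by unfold Function.uncurry; exact Continuous.stronglyMeasurable (by fun_prop))
          exact (this.measurable.comp (measurable_fst.sub measurable_snd)).aestronglyMeasurable
        · refine (norm_integral_le_of_norm_le_const (C := 1)
            (Eventually.of_forall fun s => ?_)).trans (by simp)
          simpa using Real.abs_cos_le_one (inner ℝ (q.1 - q.2) s))
      (by rw [hform h hL2]; simp)
    have h0 := ae_eq_zero_of_fourier_eq_zero hν hmeas hint hc hs
    have hm : ∫ z, h z ∂Q = 0 := integral_eq_zero_of_ae h0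
    filter_upwards [h0] with z hz
    rw [hm, hz, Pi.zero_apply]

/-! ### Consequences of the null hypothesis -/

namespace Obs

variable {px pz : ℕ}

theorem measurable_x : Measurable (Obs.x : Obs px pz → Euc px) :=
  measurable_fst.comp measurable_snd

theorem measurable_z : Measurable (Obs.z : Obs px pz → Euc pz) :=
  measurable_snd.comp measurable_snd

theorem sigmaZ_le : Obs.sigmaZ px pz ≤ (inferInstance : MeasurableSpace (Obs px pz)) :=
  measurable_z.comap_le

end Obs

namespace SpecModel

variable {px pz k pv : ℕ} {M : SpecModel px pz k pv} {P : Measure (Obs px pz)}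

theorem Null.integral_mul_U_eq_zero [IsProbabilityMeasure P] (hnull : M.Null P)
    (hU : MemLp M.U 2 P) {G : Euc pz → ℝ} (hG : Measurable G)
    (hint : Integrable (fun w => G w.z * M.U w) P) : ∫ w, G w.z * M.U w ∂P = 0 := by
  have hGm : StronglyMeasurable[Obs.sigmaZ px pz] fun w : Obs px pz => G w.z :=
    (hG.comp (comap_measurable _)).stronglyMeasurable
  have hpull := condExp_mul_of_stronglyMeasurable_left hGm hint (hU.integrable one_le_two)
  rw [← integral_condExp Obs.sigmaZ_le]
  refine integral_eq_zero_of_ae ?_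
  filter_upwards [hpull, hnull] with w hw h0
  refine hw.trans ?_
  simp [h0]

theorem MomentConditions.ae_integrable_kernel_mul [IsProbabilityMeasure P]
    (hmom : M.MomentConditions P) {g : Obs px pz → ℝ} (hg : MemLp g 2 P) :
    ∀ᵐ w ∂P, Integrable (fun w' => M.K (w.z - w'.z) * g w') P := by
  have := integrable_mul_mul_prod (memLp_const (1 : ℝ)) hg hmom.memLp_K
  filter_upwards [this.prod_right_ae] with w hw
  simpa [mul_comm] using hw

/-- With `w` frozen the kernel is a function of `Z'` alone, which the null makes orthogonal to `U'`.
The later cancellations rest on this. -/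
theorem ae_integral_kernel_mul_U_eq_zero [IsProbabilityMeasure P] (hKm : Measurable M.K)
    (hnull : M.Null P) (hmom : M.MomentConditions P) :
    ∀ᵐ w ∂P, ∫ w', M.K (w.z - w'.z) * M.U w' ∂P = 0 := by
  filter_upwards [hmom.ae_integrable_kernel_mul hmom.memLp_U] with w hw
  exact hnull.integral_mul_U_eq_zero (G := fun z => M.K (w.z - z)) hmom.memLp_U
    (hKm.comp (measurable_const.sub measurable_id)) hw

theorem measurable_muh [SFinite P] (hKm : Measurable M.K) {h : Euc pz → ℝ} (hh : Measurable h) :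
    Measurable (M.muh P h) :=
  (StronglyMeasurable.integral_prod_right
    (f := fun (z : Euc pz) (w : Obs px pz) => M.K (z - w.z) * h w.z)
    (Measurable.stronglyMeasurable
      ((hKm.comp (measurable_fst.sub (Obs.measurable_z.comp measurable_snd))).mul
        (hh.comp (Obs.measurable_z.comp measurable_snd))))).measurable

/-- If `U² G(Z)²` has mean zero, then `G(Z)` vanishes. -/
theorem ae_eq_zero_of_integral_sq_eq_zero [IsProbabilityMeasure P] (hU : MemLp M.U 2 P)
    (hvar : ∀ᵐ w ∂P, 0 < (P[fun v => M.U v ^ 2 | Obs.sigmaZ px pz]) w)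
    {G : Euc pz → ℝ} (hG : Measurable G) (hint : MemLp (fun w => M.U w * G w.z) 2 P)
    (hzero : ∫ w, (M.U w * G w.z) ^ 2 ∂P = 0) : ∀ᵐ w ∂P, G w.z = 0 := by
  have hae := (integral_eq_zero_iff_of_nonneg (fun w => sq_nonneg _) hint.integrable_sq).1 hzero
  -- Since `U` vanishes a.e. on `A`, and `A` is an event of `σ(Z)`, the conditional variance
  -- integrates to zero over `A`; being positive, it forces `A` to be null.
  set A : Set (Obs px pz) := {w | G w.z ≠ 0} with hA
  have hAm : MeasurableSet[Obs.sigmaZ px pz] A :=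
    ⟨{z | G z ≠ 0}, (hG (measurableSet_singleton 0)).compl, rfl⟩
  have hAm' : MeasurableSet A := Obs.sigmaZ_le _ hAm
  have hset : ∫ w in A, (P[fun v => M.U v ^ 2 | Obs.sigmaZ px pz]) w ∂P = 0 := by
    rw [setIntegral_condExp Obs.sigmaZ_le hU.integrable_sq hAm]
    refine integral_eq_zero_of_ae ?_
    filter_upwards [ae_restrict_of_ae hae, ae_restrict_mem hAm'] with w hw hwA
    simp only [Pi.zero_apply, mul_pow, mul_eq_zero, pow_eq_zero_iff two_ne_zero] at hw ⊢
    exact hw.resolve_right hwA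
  rw [setIntegral_eq_zero_iff_of_nonneg_ae
    (ae_restrict_of_ae (hvar.mono fun w hw => hw.le)) integrable_condExp.integrableOn] at hset
  have hset' := (ae_restrict_iff' hAm').1 hset
  filter_upwards [hset', hvar] with w hw hpos
  by_contra hne
  exact hpos.ne' (hw hne)

/-- Jensen's inequality, in the form that each section of `ψ` has nonnegative variance. -/
theorem memLp_psi1 [IsProbabilityMeasure P] (hmom : M.MomentConditions P) (l : Fin pv) :
    MemLp (fun w => M.psi1 P w l) 2 P := by
  have hψ := hmom.memLp_psi l
  have hmeas : AEStronglyMeasurable (fun w => M.psi1 P w l) P := hψ.1.integral_prod_right'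
  refine (memLp_two_iff_integrable_sq hmeas).2 ?_
  have hsq := hψ.integrable_sq
  refine hsq.integral_prod_left.mono' (hmeas.pow 2) ?_
  filter_upwards [hsq.prod_right_ae, hψ.1.prodMk_left] with w hw hwm
  have hLp : MemLp (fun w' => M.psi w w' l) 2 P := (memLp_two_iff_integrable_sq hwm).2 hw
  have := variance_eq_sub hLp
  have h0 := variance_nonneg (fun w' => M.psi w w' l) P
  rw [Real.norm_eq_abs, abs_of_nonneg (sq_nonneg _)]
  simp only [Pi.pow_apply] at this
  rw [psi1]
  linarith

end SpecModel

/-! ### Population quantities for `V = [h(Z), U - h(Z)]` -/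

/-- The direction `(1, -1)` along which `[h(Z), U - h(Z)]` varies given `Z`. -/
def contrast : Fin 2 → ℝ := ![1, -1]

namespace SpecModel

variable {px pz k : ℕ} {M : SpecModel px pz k 2} {P : Measure (Obs px pz)} {h : Euc pz → ℝ}

/-- The coefficient `(1 - contrast l) / 2` is the indicator of the second coordinate, so both
coordinates are handled at once. -/
theorem Vat_eq (hV : M.V = pairV h) (w : Obs px pz) (l : Fin 2) :
    M.Vat M.β₀ w l = contrast l * h w.z + (1 - contrast l) / 2 * M.U w := by
  fin_cases l <;> simp [Vat, hV, pairV, contrast, U]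
  ring

/-- Every term carrying `U'` averages to zero over the copy, including the `U U'` term of the second
coordinate; only `U h(Z')` remains. -/
theorem psi1_ae_eq [IsProbabilityMeasure P] (hV : M.V = pairV h) (hKm : Measurable M.K)
    (hnull : M.Null P) (hmom : M.MomentConditions P)
    (hL2 : MemLp (fun w : Obs px pz => h w.z) 2 P) (l : Fin 2) :
    (fun w => M.psi1 P w l) =ᵐ[P] fun w => contrast l / 2 * (M.U w * M.muh P h w.z) := by
  filter_upwards [hmom.ae_integrable_kernel_mul hmom.memLp_U, hmom.ae_integrable_kernel_mul hL2,
    ae_integral_kernel_mul_U_eq_zero hKm hnull hmom] with w h1 h2 h3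
  have : ∀ w', M.psi w w' l = contrast l / 2 * M.U w * (M.K (w.z - w'.z) * h w'.z) +
      (contrast l / 2 * h w.z + (1 - contrast l) / 2 * M.U w) * (M.K (w.z - w'.z) * M.U w') := by
    intro w'
    rw [psi, Vat_eq hV, Vat_eq hV]
    ring
  simp only [psi1, this]
  rw [integral_add (h2.const_mul _) (h1.const_mul _), integral_const_mul, integral_const_mul, h3,
    muh]
  ring

theorem memLp_U_mul_muh [IsProbabilityMeasure P] (hV : M.V = pairV h) (hKm : Measurable M.K)
    (hnull : M.Null P) (hmom : M.MomentConditions P)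
    (hL2 : MemLp (fun w : Obs px pz => h w.z) 2 P) :
    MemLp (fun w => M.U w * M.muh P h w.z) 2 P := by
  refine ((memLp_psi1 hmom 0).const_mul 2).ae_eq ?_
  filter_upwards [psi1_ae_eq hV hKm hnull hmom hL2 0] with w hw
  rw [hw]
  simp [contrast]

theorem OmegaV_apply [IsProbabilityMeasure P] (hV : M.V = pairV h) (hKm : Measurable M.K)
    (hh : Measurable h) (hnull : M.Null P) (hmom : M.MomentConditions P)
    (hL2 : MemLp (fun w : Obs px pz => h w.z) 2 P) (l m : Fin 2) :
    M.OmegaV P l m = contrast l * contrast m * ∫ w, (M.U w * M.muh P h w.z) ^ 2 ∂P := by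
  have hmem := memLp_U_mul_muh hV hKm hnull hmom hL2
  have hmean : ∀ l, ∫ w, M.psi1 P w l ∂P = 0 := fun l => by
    rw [integral_congr_ae (psi1_ae_eq hV hKm hnull hmom hL2 l), integral_const_mul]
    simp only [mul_comm (M.U _)]
    rw [hnull.integral_mul_U_eq_zero hmom.memLp_U (measurable_muh hKm hh), mul_zero]
    simpa only [mul_comm (M.U _)] using hmem.integrable one_le_two
  rw [OmegaV, Matrix.of_apply, covariance_eq_sub (memLp_psi1 hmom l) (memLp_psi1 hmom m), hmean,
    zero_mul, sub_zero, ← integral_const_mul, ← integral_const_mul]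
  refine integral_congr_ae ?_
  filter_upwards [psi1_ae_eq hV hKm hnull hmom hL2 l, psi1_ae_eq hV hKm hnull hmom hL2 m]
    with w hl hm
  rw [Pi.mul_apply, hl, hm]
  ring

theorem Xi2_apply [IsProbabilityMeasure P] (hV : M.V = pairV h) (hKm : Measurable M.K)
    (hnull : M.Null P) (hmom : M.MomentConditions P)
    (hL2 : MemLp (fun w : Obs px pz => h w.z) 2 P) (l : Fin 2) (a : Fin k) :
    M.Xi2 P l a =
      contrast l / 2 * ∫ w, (M.U w * M.muh P h w.z) * (M.U w * M.phi w a) ∂P := by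
  rw [Xi2, Matrix.of_apply, ← integral_const_mul]
  refine integral_congr_ae ?_
  filter_upwards [psi1_ae_eq hV hKm hnull hmom hL2 l] with w hl
  rw [hl]
  ring

/-- The copy carrying `U` is integrated first; symmetry of `K` brings the inner integral to the form
already known to vanish. -/
theorem integral_kernel_mul_U_mul_eq_zero [IsProbabilityMeasure P] (hKm : Measurable M.K)
    (hnull : M.Null P) (hmom : M.MomentConditions P) {f : Obs px pz → ℝ} (hf : MemLp f 2 P)
    (hsymm : ∀ z, M.K (-z) = M.K z) :
    ∫ q, M.U q.1 * f q.2 * M.K (q.1.z - q.2.z) ∂(P.prod P) = 0 := by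
  rw [integral_prod_symm _ (integrable_mul_mul_prod hmom.memLp_U hf hmom.memLp_K)]
  refine integral_eq_zero_of_ae ?_
  filter_upwards [ae_integral_kernel_mul_U_eq_zero hKm hnull hmom] with w hw
  have : ∀ v, M.U v * f w * M.K (v.z - w.z) = f w * (M.K (w.z - v.z) * M.U v) := fun v => by
    rw [← neg_sub w.z v.z, hsymm]
    ring
  simp only [this, integral_const_mul, hw, mul_zero, Pi.zero_apply]

theorem Xi1_apply [IsProbabilityMeasure P] (hV : M.V = pairV h) (hKm : Measurable M.K)
    (hsymm : ∀ z, M.K (-z) = M.K z) (hnull : M.Null P) (hmom : M.MomentConditions P)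
    (hxi : ∀ a l, MemLp (fun w => M.xi w a l) 2 P) (l : Fin 2) (a : Fin k) :
    M.Xi1 P l a = -(contrast l * ∫ v, M.muh P h v.z * M.r v a ∂P) := by
  have hξ : ∀ l, Integrable
      (fun q : Obs px pz × Obs px pz => M.U q.1 * M.xi q.2 a l * M.K (q.1.z - q.2.z))
      (P.prod P) := fun l => integrable_mul_mul_prod hmom.memLp_U (hxi a l) hmom.memLp_K
  -- Only the whole integrand of `Ξ₁` is assumed integrable. Its `ξ` part is integrable by square
  -- integrability, hence so is the part with `r`.
  have hVr : ∀ l, Integrable (fun q : Obs px pz × Obs px pz =>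
      M.K (q.1.z - q.2.z) * M.Vat M.β₀ q.2 l * M.r q.1 a) (P.prod P) := fun l => by
    refine ((hξ l).sub (hmom.integrable_Xi1 l a)).congr (Eventually.of_forall fun q => ?_)
    simp only [Pi.sub_apply, Xi1Integrand]
    ring
  have hhr : Integrable (fun q : Obs px pz × Obs px pz =>
      M.r q.1 a * (M.K (q.1.z - q.2.z) * h q.2.z)) (P.prod P) := by
    refine (hVr 0).congr (Eventually.of_forall fun q => ?_)
    simp only [Vat_eq hV, contrast, Matrix.cons_val_zero]
    ring
  -- The two coordinates of `V` add up to `U`.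
  have hUr : Integrable (fun q : Obs px pz × Obs px pz =>
      M.r q.1 a * (M.K (q.1.z - q.2.z) * M.U q.2)) (P.prod P) := by
    refine ((hVr 0).add (hVr 1)).congr (Eventually.of_forall fun q => ?_)
    simp only [Pi.add_apply, Vat_eq hV, contrast, Matrix.cons_val_zero, Matrix.cons_val_one]
    ring
  have eh : ∫ q, M.r q.1 a * (M.K (q.1.z - q.2.z) * h q.2.z) ∂(P.prod P) =
      ∫ v, M.muh P h v.z * M.r v a ∂P := by
    rw [integral_prod _ hhr]
    congr 1 with v
    simp only [integral_const_mul]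
    rw [muh, mul_comm]
  have eU : ∫ q, M.r q.1 a * (M.K (q.1.z - q.2.z) * M.U q.2) ∂(P.prod P) = 0 := by
    rw [integral_prod _ hUr]
    refine integral_eq_zero_of_ae ?_
    filter_upwards [ae_integral_kernel_mul_U_eq_zero hKm hnull hmom] with v hv
    simp only [integral_const_mul, hv, mul_zero, Pi.zero_apply]
  have hdecomp : ∀ q : Obs px pz × Obs px pz, M.Xi1Integrand q l a =
      M.U q.1 * M.xi q.2 a l * M.K (q.1.z - q.2.z)
        - contrast l * (M.r q.1 a * (M.K (q.1.z - q.2.z) * h q.2.z))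
        - (1 - contrast l) / 2 * (M.r q.1 a * (M.K (q.1.z - q.2.z) * M.U q.2)) := fun q => by
    rw [Xi1Integrand, Vat_eq hV]
    ring
  have hsub : Integrable (fun q : Obs px pz × Obs px pz =>
      M.U q.1 * M.xi q.2 a l * M.K (q.1.z - q.2.z)
        - contrast l * (M.r q.1 a * (M.K (q.1.z - q.2.z) * h q.2.z))) (P.prod P) :=
    (hξ l).sub (hhr.const_mul _)
  rw [Xi1, Matrix.of_apply]
  simp only [hdecomp]
  rw [integral_sub hsub (hUr.const_mul _), integral_sub (hξ l) (hhr.const_mul _),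
    integral_const_mul, integral_const_mul, eh, eU,
    integral_kernel_mul_U_mul_eq_zero hKm hnull hmom (hxi a l) hsymm]
  ring

theorem memLp_U_mul_phi (hU : MemLp M.U 2 P)
    (hφ : ∀ β, Measurable fun q : Euc px × Euc pz => M.φ q.1 q.2 β)
    (hint : ∀ a b, Integrable (fun w => M.phi w a * M.phi w b * M.U w ^ 2) P) (a : Fin k) :
    MemLp (fun w => M.U w * M.phi w a) 2 P := by
  have hm : Measurable fun w : Obs px pz => M.phi w a :=
    (measurable_pi_apply a).comp ((WithLp.measurable_ofLp 2 _).comp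
      ((hφ M.β₀).comp (Obs.measurable_x.prodMk Obs.measurable_z)))
  refine (memLp_two_iff_integrable_sq (hU.1.mul hm.aestronglyMeasurable)).2
    ((hint a a).congr (Eventually.of_forall fun w => ?_))
  simp only [Pi.mul_apply]
  ring

theorem influence_eq (w : Obs px pz) : M.influence P h w = M.U w * M.muh P h w.z -
    ∑ a, (∫ v, M.muh P h v.z * M.r v a ∂P) * (M.U w * M.phi w a) := by
  rw [influence, mul_sub, Finset.mul_sum]
  congr 1
  exact Finset.sum_congr rfl fun a _ => by ring

theorem memLp_influence (hμ : MemLp (fun w => M.U w * M.muh P h w.z) 2 P)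
    (hφ : ∀ a, MemLp (fun w => M.U w * M.phi w a) 2 P) : MemLp (M.influence P h) 2 P := by
  rw [show M.influence P h = _ from funext influence_eq]
  exact hμ.sub (memLp_finsetSum _ fun a _ => (hφ a).const_mul _)

theorem integral_influence_sq (hμ : MemLp (fun w => M.U w * M.muh P h w.z) 2 P)
    (hφ : ∀ a, MemLp (fun w => M.U w * M.phi w a) 2 P) :
    ∫ w, M.influence P h w ^ 2 ∂P = ∫ w, (M.U w * M.muh P h w.z) ^ 2 ∂P
      - 2 * ∑ a, (∫ v, M.muh P h v.z * M.r v a ∂P) *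
          (∫ w, (M.U w * M.muh P h w.z) * (M.U w * M.phi w a) ∂P)
      + ∑ a, ∑ b, (∫ v, M.muh P h v.z * M.r v a ∂P) * (∫ v, M.muh P h v.z * M.r v b ∂P) *
          M.Xi0 P a b := by
  set c : Fin k → ℝ := fun a => ∫ v, M.muh P h v.z * M.r v a ∂P with hc
  have hexp : ∀ w, M.influence P h w ^ 2 = (M.U w * M.muh P h w.z) ^ 2
      - ∑ a, 2 * c a * ((M.U w * M.muh P h w.z) * (M.U w * M.phi w a))
      + ∑ a, ∑ b, c a * c b * ((M.U w * M.phi w a) * (M.U w * M.phi w b)) := fun w => by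
    rw [influence_eq, sub_sq, sq (∑ a, _), Finset.sum_mul_sum, Finset.mul_sum]
    congr 1
    · congr 1
      exact Finset.sum_congr rfl fun a _ => by rw [hc]; ring
    · exact Finset.sum_congr rfl fun a _ => Finset.sum_congr rfl fun b _ => by rw [hc]; ring
  have i1 : ∀ a, Integrable
      (fun w => 2 * c a * ((M.U w * M.muh P h w.z) * (M.U w * M.phi w a))) P :=
    fun a => (hμ.integrable_mul (hφ a)).const_mul _
  have i2 : ∀ a b, Integrable
      (fun w => c a * c b * ((M.U w * M.phi w a) * (M.U w * M.phi w b))) P :=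
    fun a b => ((hφ a).integrable_mul (hφ b)).const_mul _
  have i3 : Integrable (fun w => (M.U w * M.muh P h w.z) ^ 2
      - ∑ a, 2 * c a * ((M.U w * M.muh P h w.z) * (M.U w * M.phi w a))) P :=
    hμ.integrable_sq.sub (integrable_finsetSum _ fun a _ => i1 a)
  simp only [hexp]
  rw [integral_add i3 (integrable_finsetSum _ fun a _ => integrable_finsetSum _ fun b _ => i2 a b),
    integral_sub hμ.integrable_sq (integrable_finsetSum _ fun a _ => i1 a),
    integral_finsetSum _ fun a _ => i1 a,
    integral_finsetSum _ fun a _ => integrable_finsetSum _ fun b _ => i2 a b, Finset.mul_sum]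
  congr 1
  · congr 1
    exact Finset.sum_congr rfl fun a _ => by rw [integral_const_mul]; ring
  · refine Finset.sum_congr rfl fun a _ => ?_
    rw [integral_finsetSum _ fun b _ => i2 a b]
    refine Finset.sum_congr rfl fun b _ => ?_
    rw [integral_const_mul, Xi0, Matrix.of_apply]
    congr 2 with w
    ring

/-- The terms `2 Ξ₁ Ξ₂'` and `2 Ξ₂ Ξ₁'` each contribute minus one copy of the cross moment, since
`Ξ₂` carries a factor `1/2`; together they give the `-2` in the expanded square of the influence. -/
theorem OmegaDelta_apply [IsProbabilityMeasure P] (hV : M.V = pairV h) (hKm : Measurable M.K)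
    (hsymm : ∀ z, M.K (-z) = M.K z) (hh : Measurable h) (hnull : M.Null P)
    (hmom : M.MomentConditions P) (hL2 : MemLp (fun w : Obs px pz => h w.z) 2 P)
    (hxi : ∀ a l, MemLp (fun w => M.xi w a l) 2 P)
    (hφ : ∀ a, MemLp (fun w => M.U w * M.phi w a) 2 P) (l m : Fin 2) :
    M.OmegaDelta P l m = contrast l * contrast m * ∫ w, M.influence P h w ^ 2 ∂P := by
  rw [integral_influence_sq (memLp_U_mul_muh hV hKm hnull hmom hL2) hφ]
  simp only [OmegaDelta, Matrix.add_apply, Matrix.smul_apply, Matrix.mul_apply,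
    Matrix.transpose_apply, OmegaV_apply hV hKm hh hnull hmom hL2,
    Xi1_apply hV hKm hsymm hnull hmom hxi, Xi2_apply hV hKm hnull hmom hL2, smul_eq_mul,
    Finset.sum_mul, Finset.mul_sum, mul_add, mul_sub]
  rw [Finset.sum_comm (γ := Fin k)]
  rw [add_assoc, ← Finset.sum_add_distrib, sub_add_eq_add_sub, add_sub_assoc, add_assoc,
    sub_eq_add_neg, ← Finset.sum_neg_distrib]
  congr 1
  congr 1
  · exact Finset.sum_congr rfl fun a _ => Finset.sum_congr rfl fun b _ => by ring
  · exact Finset.sum_congr rfl fun a _ => by ring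

end SpecModel

/-! ### Ranks, nondegeneracy of `μ_h` and the conclusion. -/

theorem rank_of_contrast_mul {A : Matrix (Fin 2) (Fin 2) ℝ} {c : ℝ}
    (hA : ∀ l m, A l m = contrast l * contrast m * c) : A.rank = if c = 0 then 0 else 1 := by
  have hle : A.rank ≤ 1 := by
    have : A = Matrix.vecMulVec contrast fun m => contrast m * c := by
      ext l m
      rw [hA, Matrix.vecMulVec_apply, mul_assoc]
    rw [this]
    exact Matrix.rank_vecMulVec_le _ _
  split_ifs with hc
  · have : A = 0 := by
      ext l m
      simp [hA, hc]
    rw [this, Matrix.rank_zero]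
  · refine le_antisymm hle (Nat.one_le_iff_ne_zero.2 fun h0 => hc ?_)
    have h1 : A.mulVecLin.range = ⊥ := Submodule.finrank_eq_zero.1 h0
    have h2 : A.mulVecLin = 0 := LinearMap.range_eq_bot.1 h1
    -- The `(0,0)` entry of the matrix is `c` itself.
    have h3 := congrFun (LinearMap.congr_fun h2 (Pi.single 0 1)) 0
    simpa [hA, contrast] using h3

theorem IsGMDDKernel.neg {d : ℕ} {ν : Measure (Euc d)} {K : Euc d → ℝ} (hK : IsGMDDKernel ν K)
    (z : Euc d) : K (-z) = K z := by
  rcases hK.2 with ⟨-, h⟩ | ⟨-, h⟩ <;> simp [h, inner_neg_left]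

/-- Transfers the Fourier argument from the law of `Z`, where it takes place, to `P`. -/
theorem SpecModel.not_ae_muh_eq_zero {px pz k pv : ℕ} {M : SpecModel px pz k pv}
    {P : Measure (Obs px pz)} [IsProbabilityMeasure P] {ν : Measure (Euc pz)} [SFinite ν]
    (hK : IsGMDDKernel ν M.K) (hν : ChargesFrequencies ν (P.map fun w => w.z))
    (hmom : M.MomentConditions P) {h : Euc pz → ℝ} (hmeas : Measurable h)
    (hL2 : MemLp (fun w : Obs px pz => h w.z) 2 P)
    (hnonconst : ¬ ∀ᵐ w ∂P, h w.z = ∫ v, h v.z ∂P) : ¬ ∀ᵐ w ∂P, M.muh P h w.z = 0 := by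
  intro hzero
  have hz : Measurable (fun w : Obs px pz => w.z) := Obs.measurable_z
  have hKm := hK.measurable
  have : IsProbabilityMeasure (P.map fun w : Obs px pz => w.z) :=
    Measure.isProbabilityMeasure_map hz.aemeasurable
  have hmap : ∀ g : Euc pz → ℝ, Measurable g →
      ∫ z, g z ∂(P.map fun w : Obs px pz => w.z) = ∫ w, g w.z ∂P := fun g hg =>
    integral_map hz.aemeasurable hg.aestronglyMeasurable
  have hsub : ∀ z, Measurable fun z' => M.K (z - z') * h z' := fun z =>
    (hKm.comp (measurable_const.sub measurable_id)).mul hmeas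
  refine hnonconst ?_
  rw [← hmap h hmeas]
  refine ae_of_ae_map hz.aemeasurable (p := fun z => h z = _)
    (hK.ae_eq_const_of_integral_eq_zero hν hmeas
      ((memLp_map_measure_iff hmeas.aestronglyMeasurable hz.aemeasurable).2 hL2) ?_ ?_)
  · rw [Measure.map_prod_map _ _ hz hz]
    exact (memLp_map_measure_iff
      (hKm.comp (measurable_fst.sub measurable_snd)).aestronglyMeasurable
      (hz.prodMap hz).aemeasurable).2 hmom.memLp_K
  · simp only [hmap _ (hsub _)]
    exact (ae_map_iff hz.aemeasurable
      (measurableSet_eq_fun (SpecModel.measurable_muh (P := P) hKm hmeas) measurable_const)).2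
      hzero

theorem mainTheorem10 {px pz k : ℕ} {Ω : Type*} [MeasurableSpace Ω]
    (μ : Measure Ω) [IsProbabilityMeasure μ]
    -- an i.i.d. sample, with common law `P`
    (W : ℕ → Ω → Obs px pz) (P : Measure (Obs px pz)) (hP : P = μ.map (W 0))
    (hindep : iIndepFun W μ) (hident : ∀ i, IdentDistrib (W i) (W 0) μ μ)
    -- the model, with `V = [h(Z), U - h(Z)]`, and an estimator
    (M : SpecModel px pz k 2) (h : Euc pz → ℝ) (hV : M.V = pairV h)
    (T : (n : ℕ) → (Fin n → Obs px pz) → Euc k)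
    -- the kernel
    (ν : Measure (Euc pz)) [SFinite ν] (hK : IsGMDDKernel ν M.K)
    (hν : ChargesFrequencies ν (P.map fun w => w.z))
    -- the conditions, under the null hypothesis
    (hnull : M.Null P) (hmom : M.MomentConditions P) (hreg : M.RegressionConditions P)
    (hest : M.EstimatorConditions P μ W T) (hexp : M.VExpansionConditions P μ W T)
    -- `h` is measurable, square-integrable and nondegenerate
    (hmeas : Measurable h) (hL2 : MemLp (fun w : Obs px pz => h w.z) 2 P)
    (hnonconst : ¬ ∀ᵐ w ∂P, h w.z = ∫ v, h v.z ∂P)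
    -- the conditional variance of the error is positive
    (hvar : ∀ᵐ w ∂P, 0 < (P[fun v => M.U v ^ 2 | Obs.sigmaZ px pz]) w) :
    (M.OmegaV P).rank = 1 ∧
      (M.OmegaDelta P).rank ≤ 1 ∧
      ((M.OmegaDelta P).rank = (M.OmegaV P).rank ↔ ¬ ∀ᵐ w ∂P, M.influence P h w = 0) := by
  have hPm : IsProbabilityMeasure P := by
    rw [hP]
    exact Measure.isProbabilityMeasure_map (hident 0).aemeasurable_fst
  have hKm := hK.measurable
  have hUμ := SpecModel.memLp_U_mul_muh hV hKm hnull hmom hL2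
  have hφ := SpecModel.memLp_U_mul_phi hmom.memLp_U hest.measurable_φ hest.integrable_Xi0
  have hδ := SpecModel.memLp_influence hUμ hφ
  have hκ : ∫ w, (M.U w * M.muh P h w.z) ^ 2 ∂P ≠ 0 := fun h0 =>
    SpecModel.not_ae_muh_eq_zero hK hν hmom hmeas hL2 hnonconst
      (SpecModel.ae_eq_zero_of_integral_sq_eq_zero hmom.memLp_U hvar
        (SpecModel.measurable_muh hKm hmeas) hUμ h0)
  have hrankV : (M.OmegaV P).rank = 1 := by
    rw [rank_of_contrast_mul (SpecModel.OmegaV_apply hV hKm hmeas hnull hmom hL2), if_neg hκ]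
  have hrankδ := rank_of_contrast_mul
    (SpecModel.OmegaDelta_apply hV hKm hK.neg hmeas hnull hmom hL2 hexp.memLp_xi hφ)
  have hiff : ∫ w, M.influence P h w ^ 2 ∂P = 0 ↔ ∀ᵐ w ∂P, M.influence P h w = 0 := by
    rw [integral_eq_zero_iff_of_nonneg (fun w => sq_nonneg _) hδ.integrable_sq]
    exact eventually_congr (Eventually.of_forall fun w => pow_eq_zero_iff two_ne_zero)
  rw [hrankV, hrankδ, ← hiff]
  refine ⟨rfl, ?_, ?_⟩ <;> split_ifs with h0 <;> simp [h0]
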